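/- Let $\delta>0$, $K\ge 0$, $T\ge 0$, $\varphi_-\in L^2(0,1)$, and let $V\in C^2(\mathbb R)$ have bounded derivatives $V'$ and $V''$ (for example the double-well potential $\frac14(y^2-1)^2$ on $[-s,s]$, modified smoothly outside $[-s,s]$ so that $V'$ and $V''$ are bounded). Write $\|\cdot\|$ for the norm of $L^2(0,1)$ and $|\cdot|$ for the supremum norm on $\mathbb R$, and let $S(t)$, $t\ge 0$, be the contraction semigroup on $L^2(0,1)$ generated by $\delta\,d^2/dx^2$ with domain $H^1_0(0,1)\cap H^2(0,1)$. For $\varphi_0\in H^1_0(0,1)$, $0\le t_0\le T$ and a control $\alpha\in L^2(t_0,T;L^2(0,1))$, a mild solution of $$\varphi_t=\delta\varphi_{xx}-\delta^{-1}V'(\varphi)+\alpha,\qquad \varphi(t_0)=\varphi_0,$$ is a function $\varphi\in C([t_0,T];L^2(0,1))$ with $$\varphi(t)=S(t-t_0)\varphi_0+\int_{t_0}^t S(t-s)\bigl(-\delta^{-1}V'(\varphi(s))+\alpha(s)\bigr)\,ds\qquad (t_0\le t\le T).$$ For every such $\varphi_0$, $t_0$ and $\alpha$ there is exactly one mild solution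 $\varphi$. Put $$v_{\varphi_0,t_0}(\alpha)=\int_{t_0}^T \tfrac12\|\alpha(t)\|^2\,dt+K\|\varphi(T)-\varphi_-\|^2,\qquad u(\varphi_0,t_0)=\inf\bigl\{v_{\varphi_0,t_0}(\alpha):\ \alpha\in L^2(t_0,T;L^2(0,1))\bigr\}.$$ Then there are constants $E,F\ge 0$, depending only on $\delta$, $K$, $T$, $\varphi_-$ and on upper bounds for $|V'|$ and $|V''|$, but not on $\varphi_0$ and $t_0$, such that for all $\varphi_0\in H^1_0(0,1)$ and $0\le t_0\le T$ $$u(\varphi_0,t_0)=\inf\bigl\{v_{\varphi_0,t_0}(\alpha):\ \alpha\in L^2(t_0,T;L^2(0,1)),\ \|\alpha\|_{L^\infty(t_0,T;L^2(0,1))}\le E\|\varphi_0\|+F\bigr\}.$$ -/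

import Mathlib

open MeasureTheory Set
open scoped ContDiff

noncomputable section

namespace GinzburgLandau

/-- Lebesgue measure on the space interval `(0,1)`. -/
abbrev spaceMeasure : Measure ℝ := volume.restrict (Ioo (0 : ℝ) 1)

/-- The Hilbert space `L²(0,1)`. -/
abbrev L2 : Type := Lp ℝ 2 spaceMeasure

/-- The pairs `(u, u')`, seen in `L²(0,1) × L²(0,1)`, with `u` a test function:
smooth, with compact support contained in `(0,1)`. -/
def testPairs : Set (L2 × L2) :=
  {p | ∃ u : ℝ → ℝ, ContDiff ℝ ∞ u ∧ HasCompactSupport u ∧ tsupport u ⊆ Ioo (0 : ℝ) 1 ∧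
    p.1 =ᵐ[spaceMeasure] u ∧ p.2 =ᵐ[spaceMeasure] deriv u}

/-- The Sobolev space `H¹₀(0,1)`: the closure of the test functions in the `H¹` norm, that is,
the `f` for which test functions `uₙ` exist with `uₙ → f` and `uₙ' → g` in `L²`, for some `g`. -/
def H10 : Set L2 := {f | ∃ g : L2, (f, g) ∈ closure testPairs}

lemma memLp_sine (n : ℕ) :
    MemLp (fun x : ℝ => √2 * Real.sin ((n + 1 : ℝ) * Real.pi * x)) 2 spaceMeasure := by
  refine MemLp.of_bound (by fun_prop) (√2) (Filter.Eventually.of_forall fun x => ?_)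
  rw [norm_mul, Real.norm_eq_abs, Real.norm_eq_abs, abs_of_nonneg (Real.sqrt_nonneg 2)]
  exact mul_le_of_le_one_right (Real.sqrt_nonneg 2) (Real.abs_sin_le_one _)

/-- The normalized Dirichlet eigenfunctions `√2 sin(kπx)`, with `k = n + 1 = 1, 2, 3, …`. -/
def sine (n : ℕ) : L2 := (memLp_sine n).toLp _

/-- The contraction semigroup `S(t)`, `t ≥ 0`, on `L²(0,1)` generated by `δ d²/dx²` with domain
`H¹₀(0,1) ∩ H²(0,1)`. The eigenpairs of this self-adjoint operator are `-δπ²k²`,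
`√2 sin(kπx)`, `k = 1, 2, 3, …`, so
`S(t) f = ∑ₖ exp(-δπ²k²t) (√2 sin(kπ·), f) √2 sin(kπ·)`, with convergence in `L²(0,1)`. -/
def heatSemigroup (δ t : ℝ) (f : L2) : L2 :=
  ∑' n : ℕ, (Real.exp (-(δ * Real.pi ^ 2 * (n + 1 : ℝ) ^ 2 * t)) * inner ℝ (sine n) f) • sine n

open Classical in
/-- The superposition `x ↦ w (f x)` as an element of `L²(0,1)`. It is always square integrable
when `w` is continuous and bounded, the only case that is used; the value `0` is a dummy. -/
def superpose (w : ℝ → ℝ) (f : L2) : L2 :=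
  if h : MemLp (fun x => w (f x)) 2 spaceMeasure then h.toLp _ else 0

/-- Lebesgue measure on the time interval from `t₀` to `T` (end points are null sets). -/
abbrev timeMeasure (t₀ T : ℝ) : Measure ℝ := volume.restrict (Ioc t₀ T)

/-- The space `L²(t₀,T;L²(0,1))` of controls, through representatives. -/
def controls (t₀ T : ℝ) : Set (ℝ → L2) := {α | MemLp α 2 (timeMeasure t₀ T)}

/-- `φ` is a mild solution on `[t₀,T]` of
`φ_t = δ φ_xx - δ⁻¹ V'(φ) + α`, `φ(t₀) = φ₀`: it lies in `C([t₀,T];L²(0,1))` and satisfies the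
variation of constants formula. -/
structure IsMildSolution (δ : ℝ) (V : ℝ → ℝ) (T t₀ : ℝ) (φ₀ : L2) (α φ : ℝ → L2) : Prop where
  continuousOn : ContinuousOn φ (Icc t₀ T)
  eq : ∀ t ∈ Icc t₀ T, φ t = heatSemigroup δ (t - t₀) φ₀ +
    ∫ s in t₀..t, heatSemigroup δ (t - s) (-(δ⁻¹ • superpose (deriv V) (φ s)) + α s)

open Classical in
/-- The state driven by the control `α`: the mild solution (dummy value if there is none). -/
def state (δ : ℝ) (V : ℝ → ℝ) (T t₀ : ℝ) (φ₀ : L2) (α : ℝ → L2) : ℝ → L2 :=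
  if h : ∃ φ, IsMildSolution δ V T t₀ φ₀ α φ then h.choose else 0

/-- The running cost `h(a) = ‖a‖² / 2`. -/
def runningCost (a : L2) : ℝ := ‖a‖ ^ 2 / 2

/-- The final cost `g(φ) = K ‖φ - φ₋‖²`. -/
def finalCost (K : ℝ) (φm φ : L2) : ℝ := K * ‖φ - φm‖ ^ 2

/-- The functional `v_{φ₀,t₀}(α) = ∫_{t₀}^T h(α(t)) dt + g(φ(T))`. -/
def cost (δ K : ℝ) (φm : L2) (V : ℝ → ℝ) (T t₀ : ℝ) (φ₀ : L2) (α : ℝ → L2) : ℝ :=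
  (∫ t in t₀..T, runningCost (α t)) + finalCost K φm (state δ V T t₀ φ₀ α T)

/-- The value function `u(φ₀,t₀)`. -/
def valueFunction (δ K : ℝ) (φm : L2) (V : ℝ → ℝ) (T : ℝ) (φ₀ : L2) (t₀ : ℝ) : ℝ :=
  sInf (cost δ K φm V T t₀ φ₀ '' controls t₀ T)

end GinzburgLandau

end

/-! Large control values do not pay. Let `β` be `α` with every value of norm above `R` replaced by
0, and let `D` be the L¹ norm of `α - β`. The running cost is quadratic, so it drops by at least
`R/2 * D` (`mul_norm_sub_truncate_le`). The semigroup is a contraction and the reaction term is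
Lipschitz, so Grönwall moves the final state by at most `D * exp(δ⁻¹M₂T)` (`norm_mild_sub_le`). If
both final states lie within `B` of `φ₋`, the final cost rises by at most `2KB` times this. Hence `R
≥ 4KB exp(δ⁻¹M₂T)` suffices (`cost_truncate_le`).

It remains to choose `B` affine in `‖φ₀‖`. Only controls at least as good as 0 matter. The cost of 0
is at most quadratic in `‖φ₀‖`, which bounds their L¹ norm linearly (`integral_norm_le_of_cost_le`);
`V'` is bounded, so the final state is then bounded linearly as well (`norm_state_le`). -/

noncomputable section

namespace GinzburgLandau

/-! ### Series along an orthonormal sequence -/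

section OrthonormalSeries

variable {H : Type*} [NormedAddCommGroup H] [InnerProductSpace ℝ H] {e : ℕ → H}

lemma norm_sq_sum_smul (he : Orthonormal ℝ e) (a : ℕ → ℝ) (s : Finset ℕ) :
    ‖∑ i ∈ s, a i • e i‖ ^ 2 = ∑ i ∈ s, a i ^ 2 := by
  rw [← real_inner_self_eq_norm_sq, he.inner_sum]
  simp [sq]

lemma hasSum_sq_of_hasSum_smul (he : Orthonormal ℝ e) {a : ℕ → ℝ} {x : H}
    (h : HasSum (fun i => a i • e i) x) : HasSum (fun i => a i ^ 2) (‖x‖ ^ 2) := by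
  have h' : Filter.Tendsto (fun s : Finset ℕ => ‖∑ i ∈ s, a i • e i‖ ^ 2) Filter.atTop
      (nhds (‖x‖ ^ 2)) := (h.norm).pow 2
  simp only [norm_sq_sum_smul he] at h'
  exact h'

lemma summable_smul_of_summable_sq [CompleteSpace H] (he : Orthonormal ℝ e) {a : ℕ → ℝ}
    (h : Summable fun i => a i ^ 2) : Summable fun i => a i • e i := by
  refine (he.orthogonalFamily.summable_iff_norm_sq_summable a).2 ?_
  simpa using h

end OrthonormalSeries

/-! ### The Dirichlet sines and the heat semigroup -/

lemma integral_cos_int_mul_pi {k : ℤ} (hk : k ≠ 0) :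
    ∫ x in (0 : ℝ)..1, Real.cos (k * Real.pi * x) = 0 := by
  have h : (k * Real.pi : ℝ) ≠ 0 := mul_ne_zero (Int.cast_ne_zero.2 hk) Real.pi_ne_zero
  rw [intervalIntegral.integral_comp_mul_left (fun x => Real.cos x) h]
  simp [Real.sin_int_mul_pi]

lemma inner_sine (m n : ℕ) : inner ℝ (sine m) (sine n) = if m = n then (1 : ℝ) else 0 := by
  have h1 : inner ℝ (sine m) (sine n) = ∫ x in (0 : ℝ)..1,
      (Real.cos (((m - n : ℤ) : ℝ) * Real.pi * x)
        - Real.cos (((m + n + 2 : ℤ) : ℝ) * Real.pi * x)) := by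
    rw [L2.inner_def, intervalIntegral.integral_of_le zero_le_one, integral_Ioc_eq_integral_Ioo]
    refine integral_congr_ae ?_
    filter_upwards [(memLp_sine m).coeFn_toLp, (memLp_sine n).coeFn_toLp] with x hm hn
    rw [sine, sine, hm, hn]
    have e1 : ((m - n : ℤ) : ℝ) * Real.pi * x
        = (m + 1 : ℝ) * Real.pi * x - (n + 1 : ℝ) * Real.pi * x := by push_cast; ring
    have e2 : ((m + n + 2 : ℤ) : ℝ) * Real.pi * x
        = (m + 1 : ℝ) * Real.pi * x + (n + 1 : ℝ) * Real.pi * x := by push_cast; ring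
    rw [e1, e2, Real.cos_sub, Real.cos_add]
    simp only [RCLike.inner_apply, conj_trivial]
    linear_combination Real.sin ((m + 1 : ℝ) * Real.pi * x) *
      Real.sin ((n + 1 : ℝ) * Real.pi * x) * Real.mul_self_sqrt (zero_le_two : (0 : ℝ) ≤ 2)
  rw [h1, intervalIntegral.integral_sub (by apply Continuous.intervalIntegrable; fun_prop)
    (by apply Continuous.intervalIntegrable; fun_prop),
    integral_cos_int_mul_pi (by omega : (m + n + 2 : ℤ) ≠ 0)]
  split_ifs with h
  · simp [h]
  · rw [integral_cos_int_mul_pi (by omega : (m - n : ℤ) ≠ 0), sub_zero]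

lemma orthonormal_sine : Orthonormal ℝ sine := orthonormal_iff_ite.2 inner_sine

/-- The factor `exp(-δπ²k²t)`, `k = n + 1`, frozen at `t = 0` for negative times. -/
def decay (δ t : ℝ) (n : ℕ) : ℝ :=
  Real.exp (-(δ * Real.pi ^ 2 * (n + 1 : ℝ) ^ 2 * max t 0))

lemma decay_nonneg (δ t : ℝ) (n : ℕ) : 0 ≤ decay δ t n := (Real.exp_pos _).le

lemma decay_le_one {δ : ℝ} (hδ : 0 < δ) (t : ℝ) (n : ℕ) : decay δ t n ≤ 1 := by
  refine Real.exp_le_one_iff.2 (neg_nonpos.2 ?_)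
  have : 0 ≤ max t 0 := le_max_right _ _
  positivity

lemma continuous_decay (δ : ℝ) (n : ℕ) : Continuous fun t => decay δ t n := by
  unfold decay; fun_prop

lemma summable_inner_sine_sq (f : L2) : Summable fun n => (inner ℝ (sine n) f) ^ 2 := by
  simpa using orthonormal_sine.inner_products_summable f

lemma sq_mul_le_sq {a b : ℝ} (ha : |a| ≤ 1) : (a * b) ^ 2 ≤ b ^ 2 := by
  rw [mul_pow]
  exact mul_le_of_le_one_left (sq_nonneg b) ((sq_le_one_iff_abs_le_one a).2 ha)

lemma abs_decay_le_one {δ : ℝ} (hδ : 0 < δ) (t : ℝ) (n : ℕ) : |decay δ t n| ≤ 1 := by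
  rw [abs_of_nonneg (decay_nonneg δ t n)]
  exact decay_le_one hδ t n

lemma summable_decay_smul {δ : ℝ} (hδ : 0 < δ) (t : ℝ) (f : L2) :
    Summable fun n => (decay δ t n * inner ℝ (sine n) f) • sine n :=
  summable_smul_of_summable_sq orthonormal_sine <|
    (summable_inner_sine_sq f).of_nonneg_of_le (fun _ => sq_nonneg _)
      fun n => sq_mul_le_sq (abs_decay_le_one hδ t n)

lemma heatSemigroup_max (δ t : ℝ) (f : L2) : heatSemigroup δ (max t 0) f =
    ∑' n, (decay δ t n * inner ℝ (sine n) f) • sine n := rfl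

/-- Bessel's inequality is enough here; completeness of the sine system plays no role. -/
lemma norm_heatSemigroup_max_le {δ : ℝ} (hδ : 0 < δ) (t : ℝ) (f : L2) :
    ‖heatSemigroup δ (max t 0) f‖ ≤ ‖f‖ := by
  rw [heatSemigroup_max]
  refine le_of_sq_le_sq ?_ (norm_nonneg f)
  have h := hasSum_sq_of_hasSum_smul orthonormal_sine (summable_decay_smul hδ t f).hasSum
  rw [← h.tsum_eq]
  refine (h.summable.tsum_le_tsum (fun n => sq_mul_le_sq (abs_decay_le_one hδ t n))
    (summable_inner_sine_sq f)).trans ?_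
  simpa using orthonormal_sine.tsum_inner_products_le f

/-- The heat semigroup as a family of bounded operators, extended to negative times by `S(0)`. -/
def heatL {δ : ℝ} (hδ : 0 < δ) (t : ℝ) : L2 →L[ℝ] L2 :=
  LinearMap.mkContinuous
    { toFun := heatSemigroup δ (max t 0)
      map_add' := fun f g => by
        simp only [heatSemigroup_max]
        rw [← (summable_decay_smul hδ t f).tsum_add (summable_decay_smul hδ t g)]
        simp only [inner_add_right, mul_add, add_smul]
      map_smul' := fun c f => by
        simp only [heatSemigroup_max, RingHom.id_apply]
        rw [← (summable_decay_smul hδ t f).tsum_const_smul c]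
        refine tsum_congr fun n => ?_
        rw [real_inner_smul_right, smul_smul]
        congr 1
        ring } 1 fun f => by
    rw [one_mul]
    exact norm_heatSemigroup_max_le hδ t f

lemma heatL_apply {δ : ℝ} (hδ : 0 < δ) {t : ℝ} (ht : 0 ≤ t) (f : L2) :
    heatL hδ t f = heatSemigroup δ t f := by
  change heatSemigroup δ (max t 0) f = _
  rw [max_eq_left ht]

lemma norm_heatL_le {δ : ℝ} (hδ : 0 < δ) (t : ℝ) : ‖heatL hδ t‖ ≤ 1 :=
  LinearMap.mkContinuous_norm_le _ zero_le_one _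

/-- The squared distance to the value at `s` is a series of continuous functions of `t`, dominated
by the squared coefficients of `f`; so it is continuous, and it vanishes at `t = s`. -/
lemma continuous_heatL {δ : ℝ} (hδ : 0 < δ) (f : L2) : Continuous fun t => heatL hδ t f := by
  refine continuous_iff_continuousAt.2 fun s => ?_
  have hsum : ∀ t, HasSum (fun n => ((decay δ t n - decay δ s n) * inner ℝ (sine n) f) ^ 2)
      (‖heatL hδ t f - heatL hδ s f‖ ^ 2) := fun t => by
    refine hasSum_sq_of_hasSum_smul orthonormal_sine ?_
    simp only [sub_mul, sub_smul]
    exact (summable_decay_smul hδ t f).hasSum.sub (summable_decay_smul hδ s f).hasSum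
  have hcont : Continuous fun t => ‖heatL hδ t f - heatL hδ s f‖ ^ 2 := by
    have : (fun t => ‖heatL hδ t f - heatL hδ s f‖ ^ 2) = fun t =>
        ∑' n, ((decay δ t n - decay δ s n) * inner ℝ (sine n) f) ^ 2 :=
      funext fun t => (hsum t).tsum_eq.symm
    rw [this]
    refine continuous_tsum (fun n => ?_) (summable_inner_sine_sq f) fun n t => ?_
    · exact (((continuous_decay δ n).sub continuous_const).mul continuous_const).pow 2
    · rw [Real.norm_of_nonneg (sq_nonneg _)]
      refine sq_mul_le_sq (abs_le.2 ⟨?_, ?_⟩) <;>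
      linarith [decay_nonneg δ t n, decay_nonneg δ s n, decay_le_one hδ t n, decay_le_one hδ s n]
  refine tendsto_iff_norm_sub_tendsto_zero.2 ?_
  have h := (hcont.tendsto s).sqrt
  simpa using h

/-! ### Superposition operators on L² -/

lemma memLp_superpose {w : ℝ → ℝ} (hw : Continuous w) {M : ℝ} (hM : ∀ y, |w y| ≤ M) (f : L2) :
    MemLp (fun x => w (f x)) 2 spaceMeasure :=
  MemLp.of_bound (hw.comp_aestronglyMeasurable (Lp.aestronglyMeasurable f)) M
    (Filter.Eventually.of_forall fun x => hM (f x))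

lemma superpose_ae {w : ℝ → ℝ} (hw : Continuous w) {M : ℝ} (hM : ∀ y, |w y| ≤ M) (f : L2) :
    superpose w f =ᵐ[spaceMeasure] fun x => w (f x) := by
  rw [superpose, dif_pos (memLp_superpose hw hM f)]
  exact MemLp.coeFn_toLp _

lemma norm_superpose_le {w : ℝ → ℝ} (hw : Continuous w) {M : ℝ} (hM : ∀ y, |w y| ≤ M) (f : L2) :
    ‖superpose w f‖ ≤ M := by
  have hM0 : 0 ≤ M := (abs_nonneg _).trans (hM 0)
  have h := Lp.norm_le_of_ae_bound (f := superpose w f) hM0 (by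
    filter_upwards [superpose_ae hw hM f] with x hx
    rw [hx]
    exact hM (f x))
  simpa [measureUnivNNReal] using h

lemma norm_superpose_sub_le {w : ℝ → ℝ} (hw : Continuous w) {M : ℝ} (hM : ∀ y, |w y| ≤ M)
    {c : ℝ} (hc : ∀ y z, |w y - w z| ≤ c * |y - z|) (f g : L2) :
    ‖superpose w f - superpose w g‖ ≤ c * ‖f - g‖ := by
  refine Lp.norm_le_mul_norm_of_ae_le_mul ?_
  filter_upwards [superpose_ae hw hM f, superpose_ae hw hM g, Lp.coeFn_sub f g,
    Lp.coeFn_sub (superpose w f) (superpose w g)] with x h1 h2 h3 h4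
  rw [h3, h4, Pi.sub_apply, Pi.sub_apply, h1, h2]
  exact hc _ _

lemma abs_sub_le_of_abs_deriv_le {w : ℝ → ℝ} (hw : Differentiable ℝ w) {c : ℝ}
    (hc : ∀ y, |deriv w y| ≤ c) (y z : ℝ) : |w y - w z| ≤ c * |y - z| :=
  convex_univ.norm_image_sub_le_of_norm_deriv_le (fun x _ => hw x) (fun x _ => hc x)
    (mem_univ z) (mem_univ y)

/-! ### Mild equations for a strongly continuous family of contractions (no semigroup law needed) -/

section MildEquations

variable {E : Type*} [NormedAddCommGroup E] [NormedSpace ℝ E] {S : ℝ → E →L[ℝ] E}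

lemma norm_apply_le_of_contraction (hS : ∀ t, ‖S t‖ ≤ 1) (t : ℝ) (x : E) : ‖S t x‖ ≤ ‖x‖ := by
  simpa using (S t).le_of_opNorm_le (hS t) x

lemma continuous_uncurry_of_contraction (hS : ∀ t, ‖S t‖ ≤ 1)
    (hc : ∀ x, Continuous fun t => S t x) : Continuous fun p : ℝ × E => S p.1 p.2 :=
  continuous_prod_of_continuous_lipschitzWith' _ 1
    (fun t => (S t).lipschitz.weaken (hS t)) hc

lemma aestronglyMeasurable_semigroup (hS : ∀ t, ‖S t‖ ≤ 1)
    (hc : ∀ x, Continuous fun t => S t x) {μ : Measure ℝ} {f : ℝ → E}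
    (hf : AEStronglyMeasurable f μ) (t : ℝ) :
    AEStronglyMeasurable (fun s => S (t - s) (f s)) μ :=
  (continuous_uncurry_of_contraction hS hc).comp_aestronglyMeasurable
    (((continuous_sub_left t).aestronglyMeasurable).prodMk hf)

lemma intervalIntegrable_semigroup (hS : ∀ t, ‖S t‖ ≤ 1)
    (hc : ∀ x, Continuous fun t => S t x) {f : ℝ → E} {a b : ℝ}
    (hf : IntervalIntegrable f volume a b) (t : ℝ) :
    IntervalIntegrable (fun s => S (t - s) (f s)) volume a b :=
  hf.mono_fun (aestronglyMeasurable_semigroup hS hc hf.def'.aestronglyMeasurable t)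
    (Filter.Eventually.of_forall fun _ => norm_apply_le_of_contraction hS _ _)

lemma norm_integral_semigroup_le (hS : ∀ t, ‖S t‖ ≤ 1) {f : ℝ → E} {a b : ℝ} (hab : a ≤ b)
    {g : ℝ → ℝ} (hg : IntervalIntegrable g volume a b) (hfg : ∀ s ∈ Ioc a b, ‖f s‖ ≤ g s)
    (t : ℝ) : ‖∫ s in a..b, S (t - s) (f s)‖ ≤ ∫ s in a..b, g s :=
  intervalIntegral.norm_integral_le_of_norm_le hab (Filter.Eventually.of_forall fun s hs =>
    (norm_apply_le_of_contraction hS _ _).trans (hfg s hs)) hg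

lemma continuous_integral_semigroup (hS : ∀ t, ‖S t‖ ≤ 1)
    (hc : ∀ x, Continuous fun t => S t x) {f : ℝ → E}
    (hf : ∀ a b, IntervalIntegrable f volume a b) (t₀ : ℝ) :
    Continuous fun t => ∫ s in t₀..t, S (t - s) (f s) := by
  refine continuous_iff_continuousAt.2 fun t₁ => ?_
  -- Dominated convergence with majorant `‖f s‖`, jointly in the parameter and the end point; the
  -- claim is its restriction to the diagonal.
  have h := intervalIntegral.continuousAt_parametric_primitive_of_dominated (μ := volume)
    (F := fun t s => S (t - s) (f s)) (x₀ := t₁) (b₀ := t₁) (a₀ := t₀) (fun s => ‖f s‖)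
    (min t₀ t₁ - 1) (max t₀ t₁ + 1)
    (fun t => aestronglyMeasurable_semigroup hS hc (hf _ _).def'.aestronglyMeasurable t)
    (Filter.Eventually.of_forall fun t => Filter.Eventually.of_forall fun s =>
      norm_apply_le_of_contraction hS _ _)
    (hf _ _).norm
    (Filter.Eventually.of_forall fun s =>
      ((hc (f s)).comp (continuous_sub_right s)).continuousAt)
    ⟨by linarith [min_le_left t₀ t₁], by linarith [le_max_left t₀ t₁]⟩
    ⟨by linarith [min_le_right t₀ t₁], by linarith [le_max_right t₀ t₁]⟩ (by simp)
  exact ContinuousAt.comp (f := fun t : ℝ => (t, t)) (x := t₁) h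
    (continuous_id.prodMk continuous_id).continuousAt

/-- The right-hand side of the mild equation, as a self-map of `C([t₀,T];E)`. -/
def mildMap (hS : ∀ t, ‖S t‖ ≤ 1) (hc : ∀ x, Continuous fun t => S t x) {G : E → E}
    (hG : Continuous G) {t₀ T : ℝ} (h : t₀ ≤ T) (y : C(ℝ, E)) (φ : C(Icc t₀ T, E)) :
    C(Icc t₀ T, E) where
  toFun t := y t + ∫ s in t₀..t, S (t - s) (G (φ (projIcc t₀ T h s)))
  continuous_toFun := (y.continuous.comp continuous_subtype_val).add
    ((continuous_integral_semigroup hS hc (fun _ _ =>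
      (hG.comp (φ.continuous.comp continuous_projIcc)).intervalIntegrable _ _) t₀).comp
        continuous_subtype_val)

lemma integral_pow_sub (t₀ t : ℝ) (n : ℕ) :
    ∫ s in t₀..t, (s - t₀) ^ n = (t - t₀) ^ (n + 1) / (n + 1) := by
  rw [intervalIntegral.integral_comp_sub_right (fun s => s ^ n), integral_pow]
  simp

/-- Each Picard step integrates the previous bound once more. The resulting factorial makes some
iterate a contraction however large `L * (T - t₀)` is. -/
lemma norm_iterate_mildMap_sub_le (hS : ∀ t, ‖S t‖ ≤ 1) (hc : ∀ x, Continuous fun t => S t x)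
    {G : E → E} (hG : Continuous G) {L : ℝ} (hL : 0 ≤ L)
    (hGL : ∀ x z, ‖G x - G z‖ ≤ L * ‖x - z‖) {t₀ T : ℝ} (h : t₀ ≤ T) (y : C(ℝ, E))
    (φ ψ : C(Icc t₀ T, E)) (n : ℕ) (t : Icc t₀ T) :
    ‖(mildMap hS hc hG h y)^[n] φ t - (mildMap hS hc hG h y)^[n] ψ t‖ ≤
      L ^ n / n.factorial * dist φ ψ * (t - t₀) ^ n := by
  induction n generalizing t with
  | zero =>
    simpa [dist_eq_norm] using ContinuousMap.dist_apply_le_dist (f := φ) (g := ψ) t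
  | succ n ih =>
    rw [Function.iterate_succ_apply', Function.iterate_succ_apply']
    set φ' := (mildMap hS hc hG h y)^[n] φ
    set ψ' := (mildMap hS hc hG h y)^[n] ψ
    have hi : ∀ χ : C(Icc t₀ T, E), IntervalIntegrable
        (fun s => S (t - s) (G (χ (projIcc t₀ T h s)))) volume t₀ t := fun χ =>
      intervalIntegrable_semigroup hS hc
        ((hG.comp (χ.continuous.comp continuous_projIcc)).intervalIntegrable _ _) t
    have e : mildMap hS hc hG h y φ' t - mildMap hS hc hG h y ψ' t = ∫ s in t₀..t, S (t - s)
        (G (φ' (projIcc t₀ T h s)) - G (ψ' (projIcc t₀ T h s))) := by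
      simp only [map_sub]
      rw [intervalIntegral.integral_sub (hi φ') (hi ψ')]
      exact add_sub_add_left_eq_sub _ _ _
    rw [e]
    refine (norm_integral_semigroup_le hS t.2.1
      (g := fun s => L * (L ^ n / n.factorial * dist φ ψ * (s - t₀) ^ n))
      (Continuous.intervalIntegrable (by fun_prop) _ _) (fun s hs => ?_) t).trans (le_of_eq ?_)
    · refine (hGL _ _).trans (mul_le_mul_of_nonneg_left ?_ hL)
      have := ih (projIcc t₀ T h s)
      rwa [projIcc_of_mem h ⟨hs.1.le, hs.2.trans t.2.2⟩] at this ⊢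
    · rw [intervalIntegral.integral_const_mul, intervalIntegral.integral_const_mul,
        integral_pow_sub, Nat.factorial_succ]
      push_cast
      field_simp
      ring

/-- Banach's theorem for an iterate of `mildMap`, whose fixed point is also fixed by the map itself.
The function `y` absorbs all terms free of the unknown, so a control that is merely integrable
enters only through a continuous function. -/
lemma exists_mild [CompleteSpace E] (hS : ∀ t, ‖S t‖ ≤ 1)
    (hc : ∀ x, Continuous fun t => S t x) {G : E → E} (hG : Continuous G) {L : ℝ} (hL : 0 ≤ L)
    (hGL : ∀ x z, ‖G x - G z‖ ≤ L * ‖x - z‖) {t₀ T : ℝ} (h : t₀ ≤ T) (y : C(ℝ, E)) :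
    ∃ φ : ℝ → E, Continuous φ ∧
      ∀ t ∈ Icc t₀ T, φ t = y t + ∫ s in t₀..t, S (t - s) (G (φ s)) := by
  obtain ⟨n, hn⟩ := ((FloorSemiring.tendsto_pow_div_factorial_atTop
    (L * (T - t₀))).eventually_lt_const zero_lt_one).exists
  have hq : 0 ≤ (L * (T - t₀)) ^ n / n.factorial := by
    have : 0 ≤ T - t₀ := sub_nonneg.2 h
    positivity
  have hcontr : ContractingWith ⟨_, hq⟩ (mildMap hS hc hG h y)^[n] := by
    refine ⟨hn, LipschitzWith.of_dist_le_mul fun φ ψ => ?_⟩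
    refine (ContinuousMap.dist_le (mul_nonneg hq dist_nonneg)).2 fun t => ?_
    rw [dist_eq_norm]
    refine (norm_iterate_mildMap_sub_le hS hc hG hL hGL h y φ ψ n t).trans ?_
    have : ((t : ℝ) - t₀) ^ n ≤ (T - t₀) ^ n :=
      pow_le_pow_left₀ (sub_nonneg.2 t.2.1) (sub_le_sub_right t.2.2 _) n
    calc L ^ n / n.factorial * dist φ ψ * ((t : ℝ) - t₀) ^ n
        ≤ L ^ n / n.factorial * dist φ ψ * (T - t₀) ^ n := by gcongr
      _ = (L * (T - t₀)) ^ n / n.factorial * dist φ ψ := by rw [mul_pow]; ring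
  have hne : Nonempty C(Icc t₀ T, E) := ⟨0⟩
  set χ := hcontr.fixedPoint (mildMap hS hc hG h y)^[n]
  have hχ : mildMap hS hc hG h y χ = χ := hcontr.isFixedPt_fixedPoint_iterate
  refine ⟨fun t => χ (projIcc t₀ T h t), χ.continuous.comp continuous_projIcc, fun t ht => ?_⟩
  have := DFunLike.congr_fun hχ ⟨t, ht⟩
  simp only [projIcc_of_mem h ht]
  exact this.symm

/-- Grönwall's inequality in integral form. -/
lemma le_mul_exp_of_le_add_integral {d : ℝ → ℝ} {A L t₀ T : ℝ} (hL : 0 ≤ L)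
    (hd : ContinuousOn d (Icc t₀ T))
    (h : ∀ t ∈ Icc t₀ T, d t ≤ A + L * ∫ s in t₀..t, d s) {t : ℝ} (ht : t ∈ Icc t₀ T) :
    d t ≤ A * Real.exp (L * (t - t₀)) := by
  have hle : t₀ ≤ T := ht.1.trans ht.2
  set D : ℝ → ℝ := fun s => d (projIcc t₀ T hle s)
  have hD : Continuous D := (continuousOn_iff_continuous_domRestrict.1 hd).comp continuous_projIcc
  have hDd : ∀ s ∈ Icc t₀ T, D s = d s := fun s hs => by simp only [D, projIcc_of_mem hle hs]
  have hint : ∀ t ∈ Icc t₀ T, ∫ s in t₀..t, D s = ∫ s in t₀..t, d s := fun t ht =>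
    intervalIntegral.integral_congr fun s hs => by
      rw [uIcc_of_le ht.1] at hs
      exact hDd s ⟨hs.1, hs.2.trans ht.2⟩
  have hderiv : ∀ s, HasDerivAt (fun t => A + L * ∫ s in t₀..t, D s) (L * D s) s := fun s =>
    ((intervalIntegral.integral_hasDerivAt_right (hD.intervalIntegrable _ _)
      (hD.stronglyMeasurableAtFilter _ _) hD.continuousAt).const_mul L).const_add A
  have hbound : ∀ s ∈ Icc t₀ T, D s ≤ A + L * ∫ s in t₀..s, D s := fun s hs => by
    rw [hDd s hs, hint s hs]
    exact h s hs
  -- The differential Grönwall inequality is applied to the right-hand side, which is differentiable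
  -- although `d` need not be.
  have hg := le_gronwallBound_of_liminf_deriv_right_le (f := fun t => A + L * ∫ s in t₀..t, D s)
    (f' := fun s => L * D s) (δ := A) (K := L) (ε := 0) (a := t₀) (b := T)
    (fun s _ => (hderiv s).continuousAt.continuousWithinAt)
    (fun s _ r hr => (hderiv s).hasDerivWithinAt.liminf_right_slope_le hr)
    (by simp) (fun s hs => by
      rw [add_zero]
      exact mul_le_mul_of_nonneg_left (hbound s ⟨hs.1, hs.2.le⟩) hL) t ht
  rw [gronwallBound_ε0] at hg
  rw [← hDd t ht]
  exact (hbound t ht).trans hg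

/-- The initial terms cancel. Extending the control integral to all of `[t₀,T]` makes it the
constant in Grönwall's inequality. -/
lemma norm_mild_sub_le (hS : ∀ t, ‖S t‖ ≤ 1) (hc : ∀ x, Continuous fun t => S t x) {G : E → E}
    (hG : Continuous G) {L : ℝ} (hL : 0 ≤ L) (hGL : ∀ x z, ‖G x - G z‖ ≤ L * ‖x - z‖)
    {t₀ T : ℝ} {x₀ : E} {α β φ ψ : ℝ → E}
    (hα : IntervalIntegrable α volume t₀ T) (hβ : IntervalIntegrable β volume t₀ T)
    (hφc : ContinuousOn φ (Icc t₀ T)) (hψc : ContinuousOn ψ (Icc t₀ T))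
    (hφ : ∀ t ∈ Icc t₀ T, φ t = S (t - t₀) x₀ + ∫ s in t₀..t, S (t - s) (G (φ s) + α s))
    (hψ : ∀ t ∈ Icc t₀ T, ψ t = S (t - t₀) x₀ + ∫ s in t₀..t, S (t - s) (G (ψ s) + β s))
    {t : ℝ} (ht : t ∈ Icc t₀ T) :
    ‖φ t - ψ t‖ ≤ (∫ s in t₀..T, ‖α s - β s‖) * Real.exp (L * (t - t₀)) := by
  refine le_mul_exp_of_le_add_integral (d := fun t => ‖φ t - ψ t‖) hL (hφc.sub hψc).norm
    (fun t ht => ?_) ht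
  have hsub : uIcc t₀ t ⊆ Icc t₀ T := by
    rw [uIcc_of_le ht.1]
    exact Icc_subset_Icc_right ht.2
  have hle : t₀ ≤ T := ht.1.trans ht.2
  have hsub' : uIcc t₀ t ⊆ uIcc t₀ T := by rwa [uIcc_of_le hle]
  have hαt := hα.mono_set hsub'
  have hβt := hβ.mono_set hsub'
  have hGi : ∀ {χ : ℝ → E}, ContinuousOn χ (Icc t₀ T) →
      IntervalIntegrable (fun s => G (χ s)) volume t₀ t := fun hχ =>
    (hG.comp_continuousOn (hχ.mono hsub)).intervalIntegrable
  have e : φ t - ψ t = ∫ s in t₀..t, S (t - s) ((G (φ s) + α s) - (G (ψ s) + β s)) := by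
    simp only [map_sub]
    rw [intervalIntegral.integral_sub
      (intervalIntegrable_semigroup hS hc ((hGi hφc).add hαt) t)
      (intervalIntegrable_semigroup hS hc ((hGi hψc).add hβt) t), hφ t ht, hψ t ht]
    exact add_sub_add_left_eq_sub _ _ _
  have hdi : IntervalIntegrable (fun s => ‖φ s - ψ s‖) volume t₀ t :=
    ((hφc.sub hψc).norm.mono hsub).intervalIntegrable
  have hni : IntervalIntegrable (fun s => ‖α s - β s‖) volume t₀ t := (hαt.sub hβt).norm
  rw [e]
  refine (norm_integral_semigroup_le hS ht.1 (g := fun s => ‖α s - β s‖ + L * ‖φ s - ψ s‖)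
    (hni.add (hdi.const_mul L)) (fun s _ => ?_) t).trans ?_
  · have : (G (φ s) + α s) - (G (ψ s) + β s) = (α s - β s) + (G (φ s) - G (ψ s)) := by abel
    rw [this]
    exact (norm_add_le _ _).trans (add_le_add_right (hGL _ _) _)
  · rw [intervalIntegral.integral_add hni (hdi.const_mul L), intervalIntegral.integral_const_mul]
    refine add_le_add_left (intervalIntegral.integral_mono_interval le_rfl ht.1 ht.2
      (Filter.Eventually.of_forall fun _ => norm_nonneg _) (hα.sub hβ).norm) _

lemma norm_mild_le (hS : ∀ t, ‖S t‖ ≤ 1) {G : E → E} {M : ℝ} (hGM : ∀ x, ‖G x‖ ≤ M)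
    {t₀ T : ℝ} (h : t₀ ≤ T) {x₀ : E} {α φ : ℝ → E} (hα : IntervalIntegrable α volume t₀ T)
    (hφ : φ T = S (T - t₀) x₀ + ∫ s in t₀..T, S (T - s) (G (φ s) + α s)) :
    ‖φ T‖ ≤ ‖x₀‖ + (T - t₀) * M + ∫ s in t₀..T, ‖α s‖ := by
  rw [hφ, add_assoc]
  refine (norm_add_le _ _).trans (add_le_add (norm_apply_le_of_contraction hS _ _) ?_)
  refine (norm_integral_semigroup_le hS h (g := fun s => M + ‖α s‖)
    (intervalIntegrable_const.add hα.norm) (fun s _ => ?_) T).trans (le_of_eq ?_)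
  · exact (norm_add_le _ _).trans (add_le_add_left (hGM _) _)
  · rw [intervalIntegral.integral_add intervalIntegrable_const hα.norm]
    simp

end MildEquations

/-! ### Truncation of controls -/

section Truncation

variable {E : Type*} [NormedAddCommGroup E]

/-- The function `f`, with the values of norm larger than `R` replaced by `0`. -/
def truncate (R : ℝ) (f : ℝ → E) : ℝ → E := {t | ‖f t‖ ≤ R}.indicator f

lemma truncate_of_le {R : ℝ} {f : ℝ → E} {t : ℝ} (h : ‖f t‖ ≤ R) : truncate R f t = f t :=
  indicator_of_mem (s := {t | ‖f t‖ ≤ R}) h f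

lemma truncate_of_lt {R : ℝ} {f : ℝ → E} {t : ℝ} (h : R < ‖f t‖) : truncate R f t = 0 :=
  indicator_of_notMem (s := {t | ‖f t‖ ≤ R}) (not_le.2 h) f

lemma norm_truncate_le_norm (R : ℝ) (f : ℝ → E) (t : ℝ) : ‖truncate R f t‖ ≤ ‖f t‖ :=
  norm_indicator_le_norm_self f t

lemma norm_truncate_le {R : ℝ} (hR : 0 ≤ R) (f : ℝ → E) (t : ℝ) : ‖truncate R f t‖ ≤ R := by
  rcases le_or_gt ‖f t‖ R with h | h
  · rwa [truncate_of_le h]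
  · rwa [truncate_of_lt h, norm_zero]

lemma memLp_truncate {μ : Measure ℝ} {p : ENNReal} (R : ℝ) {f : ℝ → E} (hf : MemLp f p μ) :
    MemLp (truncate R f) p μ :=
  hf.of_le (hf.1.indicator₀ (nullMeasurableSet_le hf.1.norm.aemeasurable aemeasurable_const))
    (Filter.Eventually.of_forall (norm_truncate_le_norm R f))

/-- Where `f` is cut off, `‖f t‖ > R`, so its square exceeds `R * ‖f t‖`; elsewhere nothing changes.
-/
lemma mul_norm_sub_truncate_le (R : ℝ) (f : ℝ → E) (t : ℝ) :
    R / 2 * ‖f t - truncate R f t‖ + ‖truncate R f t‖ ^ 2 / 2 ≤ ‖f t‖ ^ 2 / 2 := by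
  rcases le_or_gt ‖f t‖ R with h | h
  · simp [truncate_of_le h]
  · rw [truncate_of_lt h, sub_zero, norm_zero]
    nlinarith [norm_nonneg (f t)]

end Truncation

/-! ### The controlled equation and its cost -/

/-- The reaction term `-δ⁻¹ V'(φ)`. -/
def reaction (δ : ℝ) (V : ℝ → ℝ) (f : L2) : L2 := -(δ⁻¹ • superpose (deriv V) f)

/-- `V ∈ C²`, with bounds for the first two derivatives. -/
structure IsPotential (V : ℝ → ℝ) (M₁ M₂ : ℝ) : Prop where
  contDiff : ContDiff ℝ 2 V
  abs_deriv_le : ∀ y, |deriv V y| ≤ M₁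
  abs_deriv_deriv_le : ∀ y, |deriv (deriv V) y| ≤ M₂

section Control

variable {δ K T M₁ M₂ t₀ : ℝ} {V : ℝ → ℝ} {φ₀ φm : L2} {α β φ ψ : ℝ → L2}

namespace IsPotential

lemma nonneg₂ (hV : IsPotential V M₁ M₂) : 0 ≤ M₂ :=
  (abs_nonneg _).trans (hV.abs_deriv_deriv_le 0)

lemma differentiable_deriv (hV : IsPotential V M₁ M₂) : Differentiable ℝ (deriv V) :=
  ((contDiff_succ_iff_deriv (n := 1)).1 hV.contDiff).2.2.differentiable one_ne_zero

lemma norm_reaction_le (hV : IsPotential V M₁ M₂) (hδ : 0 < δ) (f : L2) :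
    ‖reaction δ V f‖ ≤ δ⁻¹ * M₁ := by
  rw [reaction, norm_neg, norm_smul, Real.norm_of_nonneg (inv_nonneg.2 hδ.le)]
  exact mul_le_mul_of_nonneg_left
    (norm_superpose_le hV.differentiable_deriv.continuous hV.abs_deriv_le f) (inv_nonneg.2 hδ.le)

lemma norm_reaction_sub_le (hV : IsPotential V M₁ M₂) (hδ : 0 < δ) (f g : L2) :
    ‖reaction δ V f - reaction δ V g‖ ≤ δ⁻¹ * M₂ * ‖f - g‖ := by
  have e : reaction δ V f - reaction δ V g
      = -(δ⁻¹ • (superpose (deriv V) f - superpose (deriv V) g)) := by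
    rw [reaction, reaction, smul_sub]
    abel
  rw [e, norm_neg, norm_smul, Real.norm_of_nonneg (inv_nonneg.2 hδ.le), mul_assoc]
  exact mul_le_mul_of_nonneg_left
    (norm_superpose_sub_le hV.differentiable_deriv.continuous hV.abs_deriv_le
      (abs_sub_le_of_abs_deriv_le hV.differentiable_deriv hV.abs_deriv_deriv_le) f g)
    (inv_nonneg.2 hδ.le)

lemma continuous_reaction (hV : IsPotential V M₁ M₂) (hδ : 0 < δ) :
    Continuous (reaction δ V) := by
  have h0 : 0 ≤ δ⁻¹ * M₂ := mul_nonneg (inv_nonneg.2 hδ.le) hV.nonneg₂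
  refine (LipschitzWith.of_dist_le_mul (K := ⟨_, h0⟩) fun f g => ?_).continuous
  rw [dist_eq_norm, dist_eq_norm]
  exact hV.norm_reaction_sub_le hδ f g

end IsPotential

lemma IsMildSolution.eq_heatL (hδ : 0 < δ) (h : IsMildSolution δ V T t₀ φ₀ α φ) :
    ∀ t ∈ Icc t₀ T, φ t = heatL hδ (t - t₀) φ₀ +
      ∫ s in t₀..t, heatL hδ (t - s) (reaction δ V (φ s) + α s) := by
  intro t ht
  rw [h.eq t ht, heatL_apply hδ (sub_nonneg.2 ht.1)]
  congr 1
  refine intervalIntegral.integral_congr fun s hs => ?_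
  rw [uIcc_of_le ht.1] at hs
  exact (heatL_apply hδ (sub_nonneg.2 hs.2) _).symm

lemma integrableOn_of_mem_controls (hα : α ∈ controls t₀ T) :
    IntegrableOn α (Ioc t₀ T) volume :=
  MemLp.integrable one_le_two hα

lemma intervalIntegrable_of_mem_controls (ht : t₀ ≤ T) (hα : α ∈ controls t₀ T) :
    IntervalIntegrable α volume t₀ T :=
  (intervalIntegrable_iff_integrableOn_Ioc_of_le ht).2 (integrableOn_of_mem_controls hα)

lemma intervalIntegrable_runningCost (ht : t₀ ≤ T) (hα : α ∈ controls t₀ T) :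
    IntervalIntegrable (fun t => runningCost (α t)) volume t₀ T :=
  (intervalIntegrable_iff_integrableOn_Ioc_of_le ht).2
    ((MemLp.integrable_norm_pow hα two_ne_zero).div_const 2)

lemma exists_isMildSolution (hV : IsPotential V M₁ M₂) (hδ : 0 < δ) (ht : t₀ ≤ T) (φ₀ : L2)
    (hα : α ∈ controls t₀ T) : ∃ φ, IsMildSolution δ V T t₀ φ₀ α φ := by
  have hS := norm_heatL_le hδ
  have hc := continuous_heatL hδ
  -- Extension by 0 makes the control integrable on every interval, so its contribution is
  -- continuous on the whole line.
  set α' := (Ioc t₀ T).indicator α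
  have hα' : ∀ a b, IntervalIntegrable α' volume a b := fun a b =>
    ((integrable_indicator_iff measurableSet_Ioc).2
      (integrableOn_of_mem_controls hα)).intervalIntegrable
  obtain ⟨φ, hφc, hφ⟩ := exists_mild hS hc (hV.continuous_reaction hδ)
    (mul_nonneg (inv_nonneg.2 hδ.le) hV.nonneg₂) (hV.norm_reaction_sub_le hδ) ht
    ⟨fun t => heatL hδ (t - t₀) φ₀ + ∫ s in t₀..t, heatL hδ (t - s) (α' s),
      ((hc φ₀).comp (continuous_sub_right t₀)).add (continuous_integral_semigroup hS hc hα' t₀)⟩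
  refine ⟨φ, hφc.continuousOn, fun t htt => ?_⟩
  have hG : IntervalIntegrable (fun s => reaction δ V (φ s)) volume t₀ t :=
    ((hV.continuous_reaction hδ).comp hφc).intervalIntegrable _ _
  rw [hφ t htt, ContinuousMap.coe_mk, add_assoc, ← intervalIntegral.integral_add
    (intervalIntegrable_semigroup hS hc (hα' _ _) t) (intervalIntegrable_semigroup hS hc hG t),
    heatL_apply hδ (sub_nonneg.2 htt.1)]
  congr 1
  rw [intervalIntegral.integral_of_le htt.1, intervalIntegral.integral_of_le htt.1]
  refine setIntegral_congr_fun measurableSet_Ioc fun s hs => ?_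
  have e : α' s = α s := indicator_of_mem (mem_Ioc.2 ⟨hs.1, hs.2.trans htt.2⟩) α
  simp only [e]
  rw [← map_add, heatL_apply hδ (sub_nonneg.2 hs.2), add_comm]
  rfl

lemma IsMildSolution.norm_sub_le (hV : IsPotential V M₁ M₂) (hδ : 0 < δ)
    (hα : α ∈ controls t₀ T) (hβ : β ∈ controls t₀ T) (hφ : IsMildSolution δ V T t₀ φ₀ α φ)
    (hψ : IsMildSolution δ V T t₀ φ₀ β ψ) {t : ℝ} (ht : t ∈ Icc t₀ T) :
    ‖φ t - ψ t‖ ≤ (∫ s in t₀..T, ‖α s - β s‖) * Real.exp (δ⁻¹ * M₂ * (t - t₀)) :=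
  norm_mild_sub_le (norm_heatL_le hδ) (continuous_heatL hδ) (hV.continuous_reaction hδ)
    (mul_nonneg (inv_nonneg.2 hδ.le) hV.nonneg₂) (hV.norm_reaction_sub_le hδ)
    (intervalIntegrable_of_mem_controls (ht.1.trans ht.2) hα)
    (intervalIntegrable_of_mem_controls (ht.1.trans ht.2) hβ) hφ.continuousOn hψ.continuousOn
    (hφ.eq_heatL hδ) (hψ.eq_heatL hδ) ht

lemma IsMildSolution.eqOn (hV : IsPotential V M₁ M₂) (hδ : 0 < δ) (hα : α ∈ controls t₀ T)
    (hφ : IsMildSolution δ V T t₀ φ₀ α φ) (hψ : IsMildSolution δ V T t₀ φ₀ α ψ) :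
    EqOn φ ψ (Icc t₀ T) := fun t ht => by
  have h := hφ.norm_sub_le hV hδ hα hα hψ ht
  simp only [sub_self, norm_zero, intervalIntegral.integral_zero, zero_mul] at h
  exact sub_eq_zero.1 (norm_le_zero_iff.1 h)

lemma isMildSolution_state (hV : IsPotential V M₁ M₂) (hδ : 0 < δ) (ht : t₀ ≤ T) (φ₀ : L2)
    (hα : α ∈ controls t₀ T) : IsMildSolution δ V T t₀ φ₀ α (state δ V T t₀ φ₀ α) := by
  have h := exists_isMildSolution hV hδ ht φ₀ hα
  rw [state, dif_pos h]
  exact h.choose_spec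

lemma norm_state_le (hV : IsPotential V M₁ M₂) (hδ : 0 < δ) (ht : t₀ ∈ Icc 0 T)
    (hα : α ∈ controls t₀ T) :
    ‖state δ V T t₀ φ₀ α T‖ ≤ ‖φ₀‖ + T * (δ⁻¹ * M₁) + ∫ s in t₀..T, ‖α s‖ := by
  have h := norm_mild_le (norm_heatL_le hδ) (hV.norm_reaction_le hδ) ht.2
    (intervalIntegrable_of_mem_controls ht.2 hα)
    ((isMildSolution_state hV hδ ht.2 φ₀ hα).eq_heatL hδ T (right_mem_Icc.2 ht.2))
  have hM : 0 ≤ δ⁻¹ * M₁ := (norm_nonneg _).trans (hV.norm_reaction_le hδ 0)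
  nlinarith [mul_nonneg ht.1 hM]

lemma cost_nonneg (hK : 0 ≤ K) (ht : t₀ ≤ T) : 0 ≤ cost δ K φm V T t₀ φ₀ α :=
  add_nonneg (intervalIntegral.integral_nonneg ht fun t _ => by rw [runningCost]; positivity)
    (mul_nonneg hK (sq_nonneg _))

lemma zero_mem_controls : (0 : ℝ → L2) ∈ controls t₀ T := MemLp.zero

lemma cost_zero_le (hV : IsPotential V M₁ M₂) (hδ : 0 < δ) (hK : 0 ≤ K) (ht : t₀ ∈ Icc 0 T) :
    cost δ K φm V T t₀ φ₀ 0 ≤ K * (‖φ₀‖ + T * (δ⁻¹ * M₁) + ‖φm‖) ^ 2 := by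
  have h := norm_state_le (φ₀ := φ₀) hV hδ ht zero_mem_controls
  simp only [Pi.zero_apply, norm_zero, intervalIntegral.integral_zero, add_zero] at h
  have h2 : ‖state δ V T t₀ φ₀ 0 T - φm‖ ≤ ‖φ₀‖ + T * (δ⁻¹ * M₁) + ‖φm‖ :=
    (norm_sub_le _ _).trans (add_le_add_left h _)
  simp only [cost, runningCost, finalCost, Pi.zero_apply, norm_zero]
  simp only [ne_eq, OfNat.ofNat_ne_zero, not_false_eq_true, zero_pow, zero_div,
    intervalIntegral.integral_zero, zero_add]
  gcongr

/-- A control that is at least as good as the control `0` has a small `L¹` norm. -/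
lemma integral_norm_le_of_cost_le (hK : 0 ≤ K) (ht : t₀ ∈ Icc 0 T)
    (hα : α ∈ controls t₀ T) {A : ℝ} (hA : 0 < A) (h : cost δ K φm V T t₀ φ₀ α ≤ K * A ^ 2) :
    ∫ s in t₀..T, ‖α s‖ ≤ (T + K) * A := by
  have h1 : ∫ t in t₀..T, runningCost (α t) ≤ K * A ^ 2 :=
    (le_add_of_nonneg_right (mul_nonneg hK (sq_nonneg _))).trans h
  have hi := intervalIntegrable_runningCost ht.2 hα
  -- Young's inequality `a ≤ A + a²/(2A)`, pointwise; the weight `A` balances the two terms so that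
  -- the bound is linear in `A`.
  have h2 : ∫ s in t₀..T, ‖α s‖ ≤ ∫ s in t₀..T, (A + A⁻¹ * runningCost (α s)) := by
    refine intervalIntegral.integral_mono_on ht.2
      (intervalIntegrable_of_mem_controls ht.2 hα).norm
      (intervalIntegrable_const.add (hi.const_mul _)) fun s _ => ?_
    rw [runningCost, ← div_eq_inv_mul, ← sub_le_iff_le_add', le_div_iff₀ hA]
    nlinarith [sq_nonneg (‖α s‖ - A), sq_nonneg A]
  refine h2.trans ?_
  rw [intervalIntegral.integral_add intervalIntegrable_const (hi.const_mul _),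
    intervalIntegral.integral_const_mul, intervalIntegral.integral_const, smul_eq_mul]
  have h3 : A⁻¹ * ∫ t in t₀..T, runningCost (α t) ≤ A⁻¹ * (K * A ^ 2) :=
    mul_le_mul_of_nonneg_left h1 (inv_nonneg.2 hA.le)
  have h4 : A⁻¹ * (K * A ^ 2) = K * A := by field_simp
  nlinarith [mul_nonneg ht.1 hA.le]

/-- Truncation at a level `R` that dominates the slope of the final cost does not increase
the cost. -/
lemma cost_truncate_le (hV : IsPotential V M₁ M₂) (hδ : 0 < δ) (hK : 0 ≤ K)
    (ht : t₀ ∈ Icc 0 T) (hα : α ∈ controls t₀ T) {B R : ℝ}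
    (hB : ‖φ₀‖ + T * (δ⁻¹ * M₁) + ‖φm‖ + ∫ s in t₀..T, ‖α s‖ ≤ B)
    (hR : 4 * K * B * Real.exp (δ⁻¹ * M₂ * T) ≤ R) :
    cost δ K φm V T t₀ φ₀ (truncate R α) ≤ cost δ K φm V T t₀ φ₀ α := by
  have hβ : truncate R α ∈ controls t₀ T := memLp_truncate R hα
  have hαi := intervalIntegrable_of_mem_controls ht.2 hα
  have hβi := intervalIntegrable_of_mem_controls ht.2 hβ
  set x := state δ V T t₀ φ₀ α T
  set z := state δ V T t₀ φ₀ (truncate R α) T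
  set D := ∫ s in t₀..T, ‖α s - truncate R α s‖
  have hD : 0 ≤ D := intervalIntegral.integral_nonneg ht.2 fun _ _ => norm_nonneg _
  have hx : ‖x - φm‖ ≤ B := by
    linarith [norm_sub_le x φm, norm_state_le (φ₀ := φ₀) hV hδ ht hα]
  have hz : ‖z - φm‖ ≤ B := by
    have : ∫ s in t₀..T, ‖truncate R α s‖ ≤ ∫ s in t₀..T, ‖α s‖ :=
      intervalIntegral.integral_mono_on ht.2 hβi.norm hαi.norm
        fun s _ => norm_truncate_le_norm R α s
    linarith [norm_sub_le z φm, norm_state_le (φ₀ := φ₀) hV hδ ht hβ]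
  have hxz : ‖x - z‖ ≤ D * Real.exp (δ⁻¹ * M₂ * T) := by
    refine ((isMildSolution_state hV hδ ht.2 φ₀ hα).norm_sub_le hV hδ hα hβ
      (isMildSolution_state hV hδ ht.2 φ₀ hβ) (right_mem_Icc.2 ht.2)).trans ?_
    have h0 : 0 ≤ δ⁻¹ * M₂ := mul_nonneg (inv_nonneg.2 hδ.le) hV.nonneg₂
    gcongr
    linarith [ht.1]
  have hrun : (R / 2 * D) + ∫ t in t₀..T, runningCost (truncate R α t)
      ≤ ∫ t in t₀..T, runningCost (α t) := by
    have hi := (hαi.sub hβi).norm.const_mul (R / 2)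
    have hj := intervalIntegrable_runningCost ht.2 hβ
    rw [← intervalIntegral.integral_const_mul, ← intervalIntegral.integral_add hi hj]
    exact intervalIntegral.integral_mono_on ht.2 (hi.add hj)
      (intervalIntegrable_runningCost ht.2 hα) fun s _ => mul_norm_sub_truncate_le R α s
  have htri : ‖z - φm‖ ≤ ‖x - φm‖ + ‖x - z‖ := by
    have := norm_sub_le (x - φm) (x - z)
    rwa [sub_sub_sub_cancel_left, ← norm_neg (z - φm), neg_sub, norm_sub_rev φm z] at this
  have hB0 : 0 ≤ B := (norm_nonneg _).trans hx
  have hfin : ‖z - φm‖ ^ 2 ≤ ‖x - φm‖ ^ 2 + 2 * B * (D * Real.exp (δ⁻¹ * M₂ * T)) := by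
    have h1 : ‖z - φm‖ ^ 2 - ‖x - φm‖ ^ 2
        = (‖z - φm‖ - ‖x - φm‖) * (‖z - φm‖ + ‖x - φm‖) := by ring
    have h2 : (‖z - φm‖ - ‖x - φm‖) * (‖z - φm‖ + ‖x - φm‖) ≤ ‖x - z‖ * (2 * B) :=
      mul_le_mul (by linarith) (by linarith) (by positivity) (norm_nonneg _)
    have h3 := mul_le_mul_of_nonneg_right hxz (by positivity : 0 ≤ 2 * B)
    linarith
  -- The gain `R/2 * D` has to cover the loss `2KB * D * exp(δ⁻¹M₂T)`, whence the factor 4 in `hR`.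
  have hKfin := mul_le_mul_of_nonneg_left hfin hK
  have hRD := mul_le_mul_of_nonneg_right hR hD
  simp only [cost, finalCost]
  change _ + K * ‖z - φm‖ ^ 2 ≤ _ + K * ‖x - φm‖ ^ 2
  linarith

/-- The bound `E‖φ₀‖ + F` is `4K exp(δ⁻¹M₂T) (1+T+K) (‖φ₀‖ + Tδ⁻¹M₁ + ‖φ₋‖ + 1)`. -/
lemma exists_bounded_control (hV : IsPotential V M₁ M₂) (hδ : 0 < δ) (hK : 0 ≤ K)
    (ht : t₀ ∈ Icc 0 T) (hα : α ∈ controls t₀ T) {R : ℝ}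
    (hR : 4 * K * ((1 + T + K) * (‖φ₀‖ + T * (δ⁻¹ * M₁) + ‖φm‖ + 1)) *
      Real.exp (δ⁻¹ * M₂ * T) ≤ R) :
    ∃ β ∈ controls t₀ T, eLpNorm β ⊤ (timeMeasure t₀ T) ≤ ENNReal.ofReal R ∧
      cost δ K φm V T t₀ φ₀ β ≤ cost δ K φm V T t₀ φ₀ α := by
  have hT : 0 ≤ T := ht.1.trans ht.2
  have hM : 0 ≤ δ⁻¹ * M₁ := (norm_nonneg _).trans (hV.norm_reaction_le hδ 0)
  have hTM := mul_nonneg hT hM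
  have hA0 : 0 ≤ ‖φ₀‖ + T * (δ⁻¹ * M₁) + ‖φm‖ := by positivity
  -- The summand 1 keeps `A` positive, as the division in Young's inequality requires.
  set A := ‖φ₀‖ + T * (δ⁻¹ * M₁) + ‖φm‖ + 1
  rcases le_total (cost δ K φm V T t₀ φ₀ 0) (cost δ K φm V T t₀ φ₀ α) with h | h
  · exact ⟨0, zero_mem_controls, by simp, h⟩
  have hA : 0 < A := by linarith
  have hR0 : 0 ≤ R := le_trans (by positivity) hR
  refine ⟨truncate R α, memLp_truncate R hα, ?_, cost_truncate_le hV hδ hK ht hα ?_ hR⟩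
  · rw [eLpNorm_exponent_top]
    exact eLpNormEssSup_le_of_ae_bound (Filter.Eventually.of_forall (norm_truncate_le hR0 α))
  -- Here `α` is no worse than 0, so its L¹ norm is at most `(T + K) * A`; hence `B = (1 + T + K) *
  -- A`.
  · have h1 := integral_norm_le_of_cost_le hK ht hα hA
      ((h.trans (cost_zero_le hV hδ hK ht)).trans (by gcongr; linarith))
    linarith

end Control

end GinzburgLandau

end

/-! ### The main theorem -/

open GinzburgLandau

theorem mainTheorem9 (δ K T M₁ M₂ : ℝ) (φm : GinzburgLandau.L2)
    (hδ : 0 < δ) (hK : 0 ≤ K) (hT : 0 ≤ T) :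
    ∃ E F : ℝ, 0 ≤ E ∧ 0 ≤ F ∧
      ∀ V : ℝ → ℝ, ContDiff ℝ 2 V → (∀ y, |deriv V y| ≤ M₁) → (∀ y, |deriv (deriv V) y| ≤ M₂) →
      ∀ φ₀ ∈ GinzburgLandau.H10, ∀ t₀ ∈ Set.Icc 0 T,
        (∀ α ∈ GinzburgLandau.controls t₀ T,
          (∃ φ, GinzburgLandau.IsMildSolution δ V T t₀ φ₀ α φ) ∧
          ∀ φ φ', GinzburgLandau.IsMildSolution δ V T t₀ φ₀ α φ →
            GinzburgLandau.IsMildSolution δ V T t₀ φ₀ α φ' → Set.EqOn φ φ' (Set.Icc t₀ T)) ∧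
        GinzburgLandau.valueFunction δ K φm V T φ₀ t₀ =
          sInf (GinzburgLandau.cost δ K φm V T t₀ φ₀ ''
            {α ∈ GinzburgLandau.controls t₀ T |
              MeasureTheory.eLpNorm α ⊤ (GinzburgLandau.timeMeasure t₀ T) ≤
                ENNReal.ofReal (E * ‖φ₀‖ + F)}) := by
  have hE : 0 ≤ 4 * K * (1 + T + K) * Real.exp (δ⁻¹ * M₂ * T) := by positivity
  -- The constants precede `V`, and `M₁` is known to be nonnegative only once a `V` is given; hence
  -- `|M₁|`.
  refine ⟨4 * K * (1 + T + K) * Real.exp (δ⁻¹ * M₂ * T),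
    4 * K * (1 + T + K) * Real.exp (δ⁻¹ * M₂ * T) * (T * (δ⁻¹ * |M₁|) + ‖φm‖ + 1),
    hE, by positivity, fun V hV₀ hV₁ hV₂ φ₀ _ t₀ ht => ?_⟩
  have hV : IsPotential V M₁ M₂ := ⟨hV₀, hV₁, hV₂⟩
  refine ⟨fun α hα => ⟨exists_isMildSolution hV hδ ht.2 φ₀ hα,
    fun φ φ' hφ hφ' => hφ.eqOn hV hδ hα hφ'⟩, ?_⟩
  rw [abs_of_nonneg ((abs_nonneg _).trans (hV₁ 0))]
  have hbdd : ∀ s : Set (ℝ → L2), BddBelow (cost δ K φm V T t₀ φ₀ '' s) := fun s =>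
    ⟨0, by rintro _ ⟨α, -, rfl⟩; exact cost_nonneg hK ht.2⟩
  refine le_antisymm (csInf_le_csInf (hbdd _) ?_ (image_mono (sep_subset _ _))) ?_
  · exact ⟨_, 0, ⟨zero_mem_controls, by simp⟩, rfl⟩
  · refine le_csInf ⟨_, 0, zero_mem_controls, rfl⟩ ?_
    rintro _ ⟨α, hα, rfl⟩
    obtain ⟨β, hβ, hβR, hle⟩ := exists_bounded_control (φ₀ := φ₀) (φm := φm) hV hδ hK ht hα
      (R := 4 * K * (1 + T + K) * Real.exp (δ⁻¹ * M₂ * T) * ‖φ₀‖ +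
        4 * K * (1 + T + K) * Real.exp (δ⁻¹ * M₂ * T) * (T * (δ⁻¹ * M₁) + ‖φm‖ + 1))
      (le_of_eq (by ring))
    refine le_trans (csInf_le (hbdd _) ?_) hle
    exact ⟨β, ⟨hβ, hβR⟩, rfl⟩
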